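/- Let $B_n$ denote the $n$-th Bernoulli number, defined by $\frac{x}{e^x-1}=\sum_{n\ge 0}\frac{B_n}{n!}x^n$. Let $p\ge 11$ be a prime and let $r\ge 2$ be an integer. Then $$\sum_{\substack{l_1+\cdots+l_6=p^r\\ l_1,\dots,l_6\ge 1,\ p\nmid l_1\cdots l_6}}\frac{1}{l_1l_2l_3l_4l_5l_6}\equiv-\frac{5!}{18}\,p^{r-1}B_{p-3}^2\pmod{p^r},$$ where the sum is over ordered 6-tuples of positive integers, and two rational numbers are congruent modulo $p^r$ if their difference is $p^r$ times a rational number whose reduced denominator is not divisible by $p$. -/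

import Mathlib

/-- The set `P_n` of positive integers that are prime to `n`. -/
def primeTo (n : ℕ) : Set ℕ :=
  {l | 0 < l ∧ Nat.Coprime l n}

/-- Congruence of rational numbers modulo `m`: the difference is `m` times a rational number
whose reduced denominator is prime to `m`. -/
def RatModEq (m : ℕ) (x y : ℚ) : Prop :=
  ∃ t : ℚ, Nat.Coprime t.den m ∧ x - y = (m : ℚ) * t

open Classical in
/-- The sum of `1 / (l₁ ⋯ lₙ)` over all ordered tuples `(l₁, …, lₙ)` with
`l₁ + ⋯ + lₙ = N` and every `lᵢ` a positive integer prime to `p`. -/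
noncomputable def recipSum (p n N : ℕ) : ℚ :=
  ∑ l ∈ (Finset.Nat.antidiagonalTuple n N).filter (fun l => ∀ i, l i ∈ primeTo p),
    1 / ∏ i, (l i : ℚ)

/-!
The sum is the coefficient of `X ^ (p ^ r)` in `f ^ 6`, where `f = ∑ Xˡ / l` over `l` prime to `p`,
a power series over the `p`-adic integers. Write `U_q` for the operator that keeps the coefficients
at multiples of `q`, and `F_q` for the truncation of `f` below degree `q = p ^ r`.

*From `p ^ r` to `p ^ (r + 1)`.* Since `1 / (y + x q) ≡ 1 / y - x q / y²` modulo `q²`,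
`f` is `F_q / (1 - X ^ q)` plus a first-order correction. In the sixth power the correction carries
a factor `q` and, at multiples of `p q`, a binomial coefficient divisible by `p`, so it disappears
modulo `p ^ (r + 1)`. Hence `U_q (F_q ^ 6)`, which has terms only in degrees `1` to `5`, determines
the coefficients of `f ^ 6` at multiples of `p q` through `U_q (F_q ^ 6) / (1 - X) ^ 6`, and one
power of `p` is gained because `(kp + 5 - j choose 5)` is divisible by `p` for `1 ≤ j ≤ 5`
(`dvd_coeff_recipSeries_pow_sub`). The coefficients of `U_q (F_q ^ 6) / (1 - X) ^ 6` are the values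
of a polynomial vanishing at `0`; replacing the argument `k` by `k p` leaves its linear term only,
and this is stable from then on (`pow_dvd_coeff_recipSeries_pow_sub`).

*The start.* For `q = p` one has `U_p (F_p ^ 6) ≡ 40 B² X² (1 - X)²` modulo `p`, with `B` the
Bernoulli number of index `p - 3` (`C_dvd_multisection_recipPoly_pow_six_sub`), so that the
polynomial is `40 B² (k³ - k) / 6`, with linear coefficient `-20 B² / 3 = -5! B² / 18`. To see this,
`F_p` is replaced by the congruent polynomial `(1 - Xᵖ - (1 - X)ᵖ) / p`, whose sixth power involves
the binomial coefficients `(pt choose pi)` with `t ≤ 6`, needed modulo `p ^ 7`. These come from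
`∏ (l + p τ) / (p - 1)! ≡ 1 + p³ x w + p⁵ y w²` with `w = τ (τ + 1)`
(`exists_prodRatio_expansion`), obtained by pairing `l` with `p - l`; the result is
`360 x² X² (1 - X)²`. The same computation for the cube gives its coefficient at `p` as `6 x`, while
partial fractions and Faulhaber's formula give `-2 B` (`toZMod_coeff_recipPoly_pow_three`).
-/

open PowerSeries Finset

/-! ### Sections of power series along an arithmetic progression -/

/-- The linear map `∑ aₙ Xⁿ ↦ ∑ a_{nq} Xⁿ` on power series. -/
noncomputable def multisection {R : Type*} [CommRing R] (q : ℕ) : R⟦X⟧ →ₗ[R] R⟦X⟧ where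
  toFun P := mk fun n => coeff (n * q) P
  map_add' _ _ := by ext; simp
  map_smul' _ _ := by ext; simp

section

variable {R : Type*} [CommRing R]

@[simp]
theorem coeff_multisection (q n : ℕ) (P : R⟦X⟧) :
    coeff n (multisection q P) = coeff (n * q) P := by
  simp [multisection]

theorem multisection_C_mul (q : ℕ) (c : R) (P : R⟦X⟧) :
    multisection q (C c * P) = C c * multisection q P := by
  ext; simp

theorem multisection_X_pow_mul {q : ℕ} (hq : 0 < q) (P : R⟦X⟧) :
    multisection q (X ^ q * P) = X * multisection q P := by
  ext n
  rcases n with _ | n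
  · simp [coeff_X_pow_mul', hq.ne']
  · rw [coeff_multisection, add_mul, one_mul, coeff_X_pow_mul, mul_comm X, coeff_succ_mul_X,
      coeff_multisection]

/-- Multisection is semilinear over the substitution `X ↦ X ^ q`; this is the instance needed for
clearing the denominators `1 - X ^ q`. -/
theorem multisection_one_sub_X_pow_mul {q : ℕ} (hq : 0 < q) (j : ℕ) (P : R⟦X⟧) :
    multisection q ((1 - X ^ q) ^ j * P) = (1 - X) ^ j * multisection q P := by
  induction j with
  | zero => simp
  | succ j ih =>
    rw [pow_succ', mul_assoc, sub_mul, one_mul, map_sub, multisection_X_pow_mul hq, ih]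
    ring

theorem C_dvd_iff_forall_dvd_coeff (c : R) (P : R⟦X⟧) :
    C c ∣ P ↔ ∀ n, c ∣ coeff n P := by
  constructor
  · rintro ⟨Q, rfl⟩ n
    simp
  · intro h
    choose g hg using h
    exact ⟨mk g, by ext n; simp [hg]⟩

theorem C_dvd_multisection {q : ℕ} {c : R} {P : R⟦X⟧} (h : C c ∣ P) :
    C c ∣ multisection q P := by
  rw [C_dvd_iff_forall_dvd_coeff] at *
  intro n
  simpa using h (n * q)

theorem coeff_one_sub_X_pow (M n : ℕ) :
    coeff n ((1 - X : R⟦X⟧) ^ M) = (-1) ^ n * (M.choose n : R) := by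
  have h : (1 - X : R⟦X⟧) ^ M = rescale (-1) (((1 + Polynomial.X) ^ M : Polynomial R) : R⟦X⟧) := by
    simp [sub_eq_add_neg]
  rw [h, coeff_rescale, Polynomial.coeff_coe, Polynomial.coeff_one_add_X_pow]

end

/-! ### The power series of reciprocals prime to `p` -/

section

variable (p : ℕ) [Fact p.Prime]

/-- The inverse of `l` in `ℤ_[p]` when `p ∤ l`, and `0` when `p ∣ l`. -/
noncomputable def recip (l : ℕ) : ℤ_[p] := if p ∣ l then 0 else (l : ℤ_[p]).inv

variable {p}

theorem cast_mul_recip {l : ℕ} (h : ¬ p ∣ l) : (l : ℤ_[p]) * recip p l = 1 := by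
  rw [recip, if_neg h]
  exact PadicInt.mul_inv (PadicInt.norm_natCast_eq_one_iff.2
    ((Nat.Prime.coprime_iff_not_dvd Fact.out).2 h))

theorem recip_of_dvd {l : ℕ} (h : p ∣ l) : recip p l = 0 := if_pos h

/-- Expansion of `1 / (y + x q)` to first order in `q`, uniformly in whether `p` divides `y`. -/
theorem sq_dvd_recip_add_mul_sub {q : ℕ} (hq : p ∣ q) (x y : ℕ) :
    (q : ℤ_[p]) ^ 2 ∣ recip p (y + x * q) - (recip p y - x * q * recip p y ^ 2) := by
  by_cases hy : p ∣ y
  · rw [recip_of_dvd hy, recip_of_dvd (dvd_add hy (hq.mul_left x))]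
    simp
  · have hy' : ¬ p ∣ y + x * q := by rwa [Nat.dvd_add_left (hq.mul_left x)]
    have h1 := cast_mul_recip hy
    have h2 := cast_mul_recip hy'
    push_cast at h2
    set a := recip p (y + x * q)
    set b := recip p y
    refine ⟨x ^ 2 * a * b ^ 2, ?_⟩
    have h3 : b - a = a * b * (x * q) := by linear_combination -b * h2 + a * h1
    linear_combination (-1 + x * q * b) * h3

theorem dvd_recip_add_sub {q : ℕ} (hq : p ∣ q) (y : ℕ) :
    (q : ℤ_[p]) ∣ recip p (y + q) - recip p y := by
  have h := (Dvd.intro_left _ (sq (q : ℤ_[p])).symm).trans (sq_dvd_recip_add_mul_sub hq 1 y)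
  have h2 := h.sub (Dvd.intro (recip p y ^ 2) rfl)
  convert h2 using 1
  simp only [one_mul, Nat.cast_one]
  ring

variable (p)

/-- The series `∑ Xˡ / l` over the `l` prime to `p`. -/
noncomputable def recipSeries : ℤ_[p]⟦X⟧ := mk (recip p)

/-- The truncation `∑ Xˡ / l` over the `l < q` prime to `p`. -/
noncomputable def recipPoly (q : ℕ) : ℤ_[p]⟦X⟧ := trunc q (recipSeries p)

/-- The polynomial `∑ Xˡ / l²` over the `l < q` prime to `p`. -/
noncomputable def recipSqPoly (q : ℕ) : ℤ_[p]⟦X⟧ := trunc q (mk fun l => recip p l ^ 2)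

variable {p}

/-- The inverses of the integers are periodic modulo `q`. -/
theorem C_dvd_recipPoly_sub {q : ℕ} (hq : p ∣ q) :
    C (q : ℤ_[p]) ∣ recipPoly p q - (1 - X ^ q) * recipSeries p := by
  rw [C_dvd_iff_forall_dvd_coeff]
  intro n
  rw [recipPoly, sub_mul, one_mul, map_sub, map_sub, Polynomial.coeff_coe, coeff_trunc,
    coeff_X_pow_mul']
  simp only [recipSeries, coeff_mk]
  rcases lt_or_ge n q with h | h
  · simp [h, h.not_ge]
  · obtain ⟨m, rfl⟩ := Nat.exists_eq_add_of_le' h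
    have := dvd_recip_add_sub (p := p) hq m
    rw [← dvd_neg] at this
    simpa [h.not_gt] using this

/-- The expansion `1 / (y + x q) ≡ 1 / y - x q / y²` modulo `q²`, summed over all `x` and all
`y < q` and multiplied by `(1 - X ^ q)²`. -/
theorem C_dvd_one_sub_sq_mul_recipSeries_sub {q c : ℕ} (hq : p ∣ q) (hc : c ∣ q ^ 2) :
    C (c : ℤ_[p]) ∣ (1 - X ^ q) ^ 2 * recipSeries p -
      ((1 - X ^ q) * recipPoly p q - C (q : ℤ_[p]) * X ^ q * recipSqPoly p q) := by
  have hc' : (c : ℤ_[p]) ∣ (q : ℤ_[p]) ^ 2 := by exact_mod_cast Nat.cast_dvd_cast hc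
  rw [C_dvd_iff_forall_dvd_coeff]
  intro n
  have e : (1 - X ^ q) ^ 2 * recipSeries p -
      ((1 - X ^ q) * recipPoly p q - C (q : ℤ_[p]) * X ^ q * recipSqPoly p q) =
      recipSeries p - X ^ q * recipSeries p - X ^ q * recipSeries p
        + X ^ q * (X ^ q * recipSeries p) - recipPoly p q + X ^ q * recipPoly p q
        + C (q : ℤ_[p]) * (X ^ q * recipSqPoly p q) := by ring
  rw [e]
  simp only [map_add, map_sub, coeff_C_mul, coeff_X_pow_mul', Polynomial.coeff_coe, recipPoly,
    recipSqPoly, coeff_trunc, recipSeries, coeff_mk]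
  rcases lt_or_ge n q with h | h
  · simp [h, h.not_ge]
  · obtain ⟨m, rfl⟩ := Nat.exists_eq_add_of_le' h
    have h1 := hc'.trans (sq_dvd_recip_add_mul_sub hq 1 m)
    rcases lt_or_ge m q with hm | hm
    · simp only [h, h.not_gt, hm, hm.not_ge, if_true, if_false, Nat.add_sub_cancel]
      convert h1 using 1
      simp
      ring
    · obtain ⟨y, rfl⟩ := Nat.exists_eq_add_of_le' hm
      have h2 := hc'.trans (sq_dvd_recip_add_mul_sub hq 2 y)
      have h3 := hc'.trans (sq_dvd_recip_add_mul_sub hq 1 y)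
      simp only [h, h.not_gt, hm, hm.not_gt, if_true, if_false, Nat.add_sub_cancel]
      rw [one_mul] at h3
      convert h2.sub (h3.mul_left 2) using 1
      rw [show y + q + q = y + 2 * q by ring]
      push_cast
      ring

theorem C_dvd_one_sub_pow_mul_recipSeries_pow_sub {q c : ℕ} (hq : p ∣ q) (hc : c ∣ q ^ 2) :
    C (c : ℤ_[p]) ∣ (1 - X ^ q) ^ 12 * recipSeries p ^ 6 -
      ((1 - X ^ q) ^ 6 * recipPoly p q ^ 6 - C (6 * q : ℤ_[p]) *
        (X ^ q * ((1 - X ^ q) ^ 5 * (recipPoly p q ^ 5 * recipSqPoly p q)))) := by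
  have h := (C_dvd_one_sub_sq_mul_recipSeries_sub hq hc).trans (sub_dvd_pow_sub_pow _ _ 6)
  have hc' : C (c : ℤ_[p]) ∣ C (q : ℤ_[p]) ^ 2 := by
    rw [← map_pow]
    exact map_dvd C (by exact_mod_cast Nat.cast_dvd_cast hc)
  -- In `(a - q b) ^ 6` all terms but the first two are divisible by `q ^ 2`.
  set a := (1 - X ^ q) * recipPoly p q with ha
  set b : ℤ_[p]⟦X⟧ := X ^ q * recipSqPoly p q with hb
  have h2 := h.add (hc'.mul_right (b ^ 2 * (15 * a ^ 4 - 20 * a ^ 3 * (C (q : ℤ_[p]) * b)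
    + 15 * a ^ 2 * (C (q : ℤ_[p]) * b) ^ 2 - 6 * a * (C (q : ℤ_[p]) * b) ^ 3
    + (C (q : ℤ_[p]) * b) ^ 4)))
  convert h2 using 1
  rw [mul_assoc (C (q : ℤ_[p])), ← hb]
  have e : C (6 * q : ℤ_[p]) = 6 * C (q : ℤ_[p]) := by
    rw [map_mul, map_ofNat]
  rw [e, show X ^ q * ((1 - X ^ q) ^ 5 * (recipPoly p q ^ 5 * recipSqPoly p q))
    = a ^ 5 * b by rw [ha, hb]; ring]
  rw [show (1 - X ^ q) ^ 6 * recipPoly p q ^ 6 = a ^ 6 by rw [ha]; ring]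
  ring

/-- The geometric series `∑ Xⁿ = 1 / (1 - X)`. -/
noncomputable abbrev geomSeries (R : Type*) [CommRing R] : R⟦X⟧ := mk 1

theorem geomSeries_pow_mul_one_sub_pow {R : Type*} [CommRing R] (n : ℕ) :
    geomSeries R ^ n * (1 - X) ^ n = 1 := by
  rw [← mul_pow, mk_one_mul_one_sub_eq_one, one_pow]

theorem coeff_geomSeries_pow_mul {R : Type*} [CommRing R] (d n : ℕ) (W : R⟦X⟧) :
    coeff n (geomSeries R ^ (d + 1) * W) =
      ∑ x ∈ antidiagonal n, ((d + x.1).choose d : R) * coeff x.2 W := by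
  rw [mk_one_pow_eq_mk_choose_add, coeff_mul]
  simp

/-- Sections along multiples of `q = p ^ r` of the sixth power of the series of reciprocals,
to one more `p`-adic digit than the period `q` of the coefficients modulo `q` provides. -/
theorem C_dvd_multisection_recipSeries_pow_sub {q c : ℕ} (hq0 : 0 < q) (hq : p ∣ q)
    (hc : c ∣ q ^ 2) :
    C (c : ℤ_[p]) ∣ multisection q (recipSeries p ^ 6) -
      (geomSeries ℤ_[p] ^ 6 * multisection q (recipPoly p q ^ 6) - C (6 * q : ℤ_[p]) *
        (X * (geomSeries ℤ_[p] ^ 7 * multisection q (recipPoly p q ^ 5 * recipSqPoly p q)))) := by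
  have h := (C_dvd_multisection (q := q) (C_dvd_one_sub_pow_mul_recipSeries_pow_sub hq hc)).mul_left
    (geomSeries ℤ_[p] ^ 12)
  rw [map_sub, map_sub, multisection_C_mul, multisection_one_sub_X_pow_mul hq0,
    multisection_one_sub_X_pow_mul hq0, multisection_X_pow_mul hq0,
    multisection_one_sub_X_pow_mul hq0] at h
  convert h using 1
  have e12 := geomSeries_pow_mul_one_sub_pow (R := ℤ_[p]) 12
  have e6 := geomSeries_pow_mul_one_sub_pow (R := ℤ_[p]) 6
  have e5 := geomSeries_pow_mul_one_sub_pow (R := ℤ_[p]) 5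
  generalize multisection q (recipSeries p ^ 6) = A
  generalize multisection q (recipPoly p q ^ 6) = B
  generalize multisection q (recipPoly p q ^ 5 * recipSqPoly p q) = D
  generalize geomSeries ℤ_[p] = J at *
  linear_combination (-A) * e12 + J ^ 6 * B * e6 - C (6 * q : ℤ_[p]) * X * J ^ 7 * D * e5

/-- The coefficients at multiples of `q` of the sixth power of the truncated series are recovered
modulo `q` from those of the full series. -/
theorem C_dvd_multisection_recipPoly_pow_sub {q : ℕ} (hq0 : 0 < q) (hq : p ∣ q) :
    C (q : ℤ_[p]) ∣ multisection q (recipPoly p q ^ 6) -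
      (1 - X) ^ 6 * multisection q (recipSeries p ^ 6) := by
  have h := C_dvd_multisection (q := q)
    ((C_dvd_recipPoly_sub hq).trans (sub_dvd_pow_sub_pow _ _ 6))
  rwa [mul_pow, map_sub, multisection_one_sub_X_pow_mul hq0] at h

/-- A product of six polynomials of degree less than `q` without constant term has no
coefficient at `m q` unless `1 ≤ m ≤ 5`. -/
theorem coeff_multisection_pow_mul_eq_zero {R : Type*} [CommRing R] {q : ℕ}
    {P Q : Polynomial R} (hP0 : P.coeff 0 = 0) (hP : P.natDegree < q) (hQ : Q.natDegree < q)
    {m : ℕ} (hm : ¬ (1 ≤ m ∧ m ≤ 5)) :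
    coeff m (multisection q (P ^ 5 * Q : R⟦X⟧)) = 0 := by
  rw [coeff_multisection]
  have e : (P : R⟦X⟧) ^ 5 * Q = ((P ^ 5 * Q : Polynomial R) : R⟦X⟧) := by simp
  rw [e, Polynomial.coeff_coe]
  rcases Nat.eq_zero_or_pos m with rfl | hm0
  · rw [zero_mul, Polynomial.mul_coeff_zero, Polynomial.coeff_zero_eq_eval_zero,
      Polynomial.eval_pow, ← Polynomial.coeff_zero_eq_eval_zero, hP0]
    simp
  · apply Polynomial.coeff_eq_zero_of_natDegree_lt
    have h1 : (P ^ 5).natDegree ≤ 5 * P.natDegree := Polynomial.natDegree_pow_le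
    have h2 := Polynomial.natDegree_mul_le (p := P ^ 5) (q := Q)
    have h3 : 6 * q ≤ m * q := Nat.mul_le_mul_right q (by omega)
    omega

theorem prime_dvd_choose_of_lt {a d s : ℕ} (hs : s < d) (hd : d < p) :
    p ∣ (p * a + s).choose d := by
  have h := Choose.choose_modEq_choose_mod_mul_choose_div_nat (n := p * a + s) (k := d) (p := p)
  rw [Nat.mul_add_mod, Nat.mod_eq_of_lt (hs.trans hd), Nat.mod_eq_of_lt hd,
    Nat.choose_eq_zero_of_lt hs, zero_mul] at h
  exact (Nat.modEq_zero_iff_dvd).1 h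

/-- The coefficients of `(1 - X)⁻⁶` that contribute are `(kp + 5 - j choose 5)` with `1 ≤ j ≤ 5`,
all divisible by `p`. -/
theorem dvd_coeff_geomSeries_pow_six_mul (hp : 7 ≤ p) {c : ℤ_[p]} {W : ℤ_[p]⟦X⟧}
    (hc : C c ∣ W) (hW : ∀ m, ¬ (1 ≤ m ∧ m ≤ 5) → coeff m W = 0) (k : ℕ) :
    p * c ∣ coeff (k * p) (geomSeries ℤ_[p] ^ 6 * W) := by
  rw [coeff_geomSeries_pow_mul 5]
  refine dvd_sum fun x hx => ?_
  rw [HasAntidiagonal.mem_antidiagonal] at hx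
  by_cases h : 1 ≤ x.2 ∧ x.2 ≤ 5
  · refine mul_dvd_mul ?_ ((C_dvd_iff_forall_dvd_coeff _ _).1 hc _)
    refine Nat.cast_dvd_cast ?_
    rw [show 5 + x.1 = p * k + (5 - x.2) by rw [mul_comm p]; omega]
    exact prime_dvd_choose_of_lt (by omega) (by omega)
  · simp [hW _ h]

/-- The coefficients of `X (1 - X)⁻⁷` that contribute are `(kp + 5 - j choose 6)` with
`1 ≤ j ≤ 5`, all divisible by `p`. -/
theorem dvd_coeff_X_mul_geomSeries_pow_seven_mul (hp : 7 ≤ p) {W : ℤ_[p]⟦X⟧}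
    (hW : ∀ m, ¬ (1 ≤ m ∧ m ≤ 5) → coeff m W = 0) (k : ℕ) :
    (p : ℤ_[p]) ∣ coeff (k * p) (X * (geomSeries ℤ_[p] ^ 7 * W)) := by
  rcases hn : k * p with _ | n
  · simp
  rw [mul_comm X, coeff_succ_mul_X, coeff_geomSeries_pow_mul 6]
  refine dvd_sum fun x hx => ?_
  rw [HasAntidiagonal.mem_antidiagonal] at hx
  by_cases h : 1 ≤ x.2 ∧ x.2 ≤ 5
  · refine Dvd.dvd.mul_right ?_ _
    refine Nat.cast_dvd_cast ?_
    rw [show 6 + x.1 = p * k + (5 - x.2) by rw [mul_comm p]; omega]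
    exact prime_dvd_choose_of_lt (by omega) (by omega)
  · simp [hW _ h]

theorem natDegree_trunc_lt_self {R : Type*} [CommRing R] {q : ℕ} (hq : 0 < q) (f : R⟦X⟧) :
    (trunc q f).natDegree < q := by
  obtain ⟨n, rfl⟩ := Nat.exists_eq_succ_of_ne_zero hq.ne'
  exact natDegree_trunc_lt _ _

theorem coeff_multisection_recipPoly_pow_mul_eq_zero {q : ℕ} (hq : 0 < q) (f : ℤ_[p]⟦X⟧) {m : ℕ}
    (hm : ¬ (1 ≤ m ∧ m ≤ 5)) :
    coeff m (multisection q (recipPoly p q ^ 5 * ((trunc q f : Polynomial ℤ_[p]) : ℤ_[p]⟦X⟧))) = 0 :=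
  coeff_multisection_pow_mul_eq_zero
    (P := trunc q (recipSeries p)) (Q := trunc q f)
    (by simp [coeff_trunc, recipSeries, recip_of_dvd]) (natDegree_trunc_lt_self hq _)
    (natDegree_trunc_lt_self hq _) hm

theorem coeff_multisection_recipPoly_pow_eq_zero {q : ℕ} (hq : 0 < q) {m : ℕ}
    (hm : ¬ (1 ≤ m ∧ m ≤ 5)) :
    coeff m (multisection q (recipPoly p q ^ 6)) = 0 := by
  rw [pow_succ]
  exact coeff_multisection_recipPoly_pow_mul_eq_zero hq (recipSeries p) hm

/-- Passage from `p ^ r` to `p ^ (r + 1)`: if the coefficients of the sixth power of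
`recipPoly p (p ^ r)` at multiples of `p ^ r` are `p ^ (r - 1)` times those of `s` modulo `p ^ r`,
the coefficients of the sixth power of `recipSeries p` at multiples of `p ^ (r + 1)` are known
modulo `p ^ (r + 1)`. -/
theorem dvd_coeff_recipSeries_pow_sub (hp : 7 ≤ p) {r : ℕ} {s : ℤ_[p]⟦X⟧}
    (hs0 : ∀ m, ¬ (1 ≤ m ∧ m ≤ 5) → coeff m s = 0)
    (hs : C ((p : ℤ_[p]) ^ (r + 1)) ∣
      multisection (p ^ (r + 1)) (recipPoly p (p ^ (r + 1)) ^ 6) -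
        C ((p : ℤ_[p]) ^ r) * s) (k : ℕ) :
    (p : ℤ_[p]) ^ (r + 2) ∣ coeff (k * p ^ (r + 2)) (recipSeries p ^ 6) -
      p ^ r * coeff (k * p) (geomSeries ℤ_[p] ^ 6 * s) := by
  have hq0 : 0 < p ^ (r + 1) := pow_pos (by omega) _
  have h1 := C_dvd_multisection_recipSeries_pow_sub (p := p) (q := p ^ (r + 1)) (c := p ^ (r + 2))
    hq0 (dvd_pow_self p (by omega)) (by rw [← pow_mul]; exact pow_dvd_pow p (by omega))
  have h2 := (C_dvd_iff_forall_dvd_coeff _ _).1 h1 (k * p)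
  have h3 := dvd_coeff_geomSeries_pow_six_mul hp hs (fun m hm => by
    rw [map_sub, coeff_multisection_recipPoly_pow_eq_zero hq0 hm, coeff_C_mul, hs0 m hm]
    simp) k
  have h4 := dvd_coeff_X_mul_geomSeries_pow_seven_mul hp
    (W := multisection (p ^ (r + 1)) (recipPoly p (p ^ (r + 1)) ^ 5 * recipSqPoly p (p ^ (r + 1))))
    (fun m hm => coeff_multisection_recipPoly_pow_mul_eq_zero hq0 _ hm) k
  rw [map_sub, map_sub, coeff_C_mul, coeff_multisection] at h2
  rw [mul_sub, map_sub, mul_left_comm, coeff_C_mul] at h3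
  have h5 : (p : ℤ_[p]) ^ (r + 2) ∣ 6 * (p ^ (r + 1) : ℕ) *
      coeff (k * p) (X * (geomSeries ℤ_[p] ^ 7 *
        multisection (p ^ (r + 1)) (recipPoly p (p ^ (r + 1)) ^ 5 *
          recipSqPoly p (p ^ (r + 1))))) := by
    obtain ⟨z, hz⟩ := h4
    rw [hz]
    exact ⟨6 * z, by push_cast; ring⟩
  rw [show (p : ℤ_[p]) * p ^ (r + 1) = p ^ (r + 2) by ring] at h3
  push_cast at h2
  push_cast at h5
  convert (h2.sub h5).add h3 using 1
  rw [show k * p ^ (r + 2) = k * p * p ^ (r + 1) by ring]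
  ring

end

/-! ### Binomial coefficients `(pt choose pi)` modulo `p ^ 7` -/

@[to_additive]
theorem prod_range_cast_zmod {M : Type*} [CommMonoid M] (p : ℕ) [NeZero p] (f : ZMod p → M) :
    ∏ i ∈ range p, f i = ∏ a, f a :=
  prod_bij' (fun i _ => (i : ZMod p)) (fun a _ => a.val) (by simp)
    (fun a _ => by simp [ZMod.val_lt])
    (fun i hi => ZMod.val_cast_of_lt (mem_range.1 hi)) (by simp) (by simp)

theorem prod_Icc_eq_factorial (n : ℕ) : ∏ i ∈ Icc 1 n, i = n.factorial := by
  induction n with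
  | zero => simp
  | succ n ih => rw [prod_Icc_succ_top (by omega), ih, Nat.factorial_succ, mul_comm]

/-- The polynomial `∏ (i (p - i) + X)` over `1 ≤ i ≤ (p - 1) / 2`. -/
noncomputable def pairProd (p : ℕ) : Polynomial ℤ :=
  ∏ i ∈ Icc 1 ((p - 1) / 2), (Polynomial.X + Polynomial.C (i * (p - i) : ℤ))

theorem prod_Icc_eq_prod_half {M : Type*} [CommMonoid M] {p h : ℕ} (hp : p = 2 * h + 1)
    (f : ℕ → M) : ∏ i ∈ Icc 1 (p - 1), f i = ∏ i ∈ Icc 1 h, (f i * f (p - i)) := by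
  have e : Icc 1 (p - 1) = Icc 1 h ∪ Icc (h + 1) (p - 1) := by
    ext i; simp only [mem_union, mem_Icc]; omega
  rw [e, prod_union (by
    rw [disjoint_left]; intro i; simp only [mem_Icc]; omega), prod_mul_distrib]
  congr 1
  refine prod_nbij' (fun i => p - i) (fun i => p - i) ?_ ?_ ?_ ?_ ?_ <;>
    simp only [mem_Icc] <;> intro i hi
  · omega
  · omega
  · omega
  · omega
  · congr 1; omega

/-- Pairing the factors `i` and `p - i` in the product of the `i + p τ`. -/
theorem prod_add_mul_eq_eval_pairProd {p : ℕ} (hp : Odd p) (τ : ℕ) :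
    ((∏ i ∈ Icc 1 (p - 1), (i + p * τ) : ℕ) : ℤ) =
      (pairProd p).eval ((p : ℤ) ^ 2 * (τ * (τ + 1))) := by
  obtain ⟨h, hh⟩ := hp
  rw [prod_Icc_eq_prod_half hh, pairProd, show (p - 1) / 2 = h by omega,
    Polynomial.eval_prod, Nat.cast_prod]
  refine prod_congr rfl fun i hi => ?_
  rw [mem_Icc] at hi
  have hi' : i ≤ p := by omega
  push_cast [Nat.cast_sub hi']
  simp
  ring

/-- Modulo `p`, `pairProd p` is `∏ (X - i²)` over the nonzero squares `i²`. -/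
theorem map_pairProd {p : ℕ} [Fact p.Prime] (hp : Odd p) :
    (pairProd p).map (Int.castRingHom (ZMod p)) = Polynomial.X ^ ((p - 1) / 2) - 1 := by
  obtain ⟨h, hh⟩ := hp
  have hh' : (p - 1) / 2 = h := by omega
  -- It suffices to compare after `X ↦ X²`, where `X² - i² = (X - i) (X - (p - i))` modulo `p`.
  apply Polynomial.expand_injective (R := ZMod p) (n := 2) (by norm_num)
  have h1 : ∏ i ∈ Icc 1 (p - 1), (Polynomial.X - Polynomial.C (i : ZMod p)) =
      Polynomial.X ^ (p - 1) - 1 := by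
    have hp1 : 1 < p := (Fact.out : p.Prime).one_lt
    have h2 : ∏ a : ZMod p, (Polynomial.X - Polynomial.C a) = Polynomial.X ^ p - Polynomial.X := by
      have hroots := FiniteField.roots_X_pow_card_sub_X (ZMod p)
      rw [ZMod.card] at hroots
      have h3 := Polynomial.prod_multiset_X_sub_C_of_monic_of_roots_card_eq
        (p := (Polynomial.X ^ p - Polynomial.X : Polynomial (ZMod p)))
        (Polynomial.monic_X_pow_sub (by simpa using hp1))
        (by rw [hroots, FiniteField.X_pow_card_sub_X_natDegree_eq _ hp1]; simp [ZMod.card])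
      rw [hroots] at h3
      exact h3
    rw [← prod_range_cast_zmod p (fun a => Polynomial.X - Polynomial.C a), range_eq_Ico,
      prod_eq_prod_Ico_succ_bot hp1.pos] at h2
    have e : Ico (0 + 1) p = Icc 1 (p - 1) := by ext i; simp only [mem_Ico, mem_Icc]; omega
    rw [e] at h2
    apply mul_left_cancel₀ (Polynomial.X_ne_zero (R := ZMod p))
    rw [mul_sub, ← pow_succ', Nat.sub_add_cancel hp1.le, mul_one, ← h2]
    simp
  rw [prod_Icc_eq_prod_half hh] at h1
  rw [pairProd, hh', Polynomial.map_prod, map_prod, map_sub, map_pow, map_one,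
    Polynomial.expand_X, ← pow_mul, show 2 * h = p - 1 by omega, ← h1]
  refine prod_congr rfl fun i hi => ?_
  rw [mem_Icc] at hi
  have hi' : i ≤ p := by omega
  simp [Nat.cast_sub hi']
  ring

/-- The hypothesis `11 ≤ p` makes `X ^ ((p - 1) / 2)` of degree greater than `3`. -/
theorem dvd_coeff_pairProd {p : ℕ} [Fact p.Prime] (hp : 11 ≤ p) {k : ℕ} (hk0 : 0 < k)
    (hk : k < 4) : (p : ℤ) ∣ (pairProd p).coeff k := by
  have h := congrArg (fun P => Polynomial.coeff P k)
    (map_pairProd ((Fact.out : p.Prime).odd_of_ne_two (by omega)))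
  simp only [Polynomial.coeff_map, Polynomial.coeff_sub, Polynomial.coeff_X_pow,
    Polynomial.coeff_one] at h
  rw [if_neg (by omega), if_neg (by omega), sub_zero] at h
  exact (ZMod.intCast_zmod_eq_zero_iff_dvd _ _).1 h

/-- Separating the multiples of `p` among the factors of `(p t)!`. -/
theorem factorial_prime_mul {p : ℕ} (hp : 0 < p) (t : ℕ) :
    (p * t).factorial =
      p ^ t * t.factorial * ∏ τ ∈ range t, ∏ i ∈ Icc 1 (p - 1), (i + p * τ) := by
  induction t with
  | zero => simp
  | succ t ih =>
    have h : ∀ n, (p * t + n).factorial = (p * t).factorial * ∏ i ∈ Icc 1 n, (i + p * t) := by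
      intro n
      induction n with
      | zero => simp
      | succ n ihn =>
        rw [← add_assoc, Nat.factorial_succ, ihn, prod_Icc_succ_top (by omega)]
        ring
    have h1 : p * (t + 1) = p * t + (p - 1) + 1 := by rw [mul_add]; omega
    rw [h1, Nat.factorial_succ, h, ih, prod_range_succ, pow_succ, Nat.factorial_succ, ← h1]
    ring

theorem choose_prime_mul_mul_prod {p : ℕ} (hp : 0 < p) (i j : ℕ) :
    (p * (i + j)).choose (p * i) * ((∏ τ ∈ range i, ∏ l ∈ Icc 1 (p - 1), (l + p * τ)) *
      ∏ τ ∈ range j, ∏ l ∈ Icc 1 (p - 1), (l + p * τ)) =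
      (i + j).choose i * ∏ τ ∈ range (i + j), ∏ l ∈ Icc 1 (p - 1), (l + p * τ) := by
  have h1 := Nat.add_choose_mul_factorial_mul_factorial (p * i) (p * j)
  have h2 := Nat.add_choose_mul_factorial_mul_factorial i j
  rw [← mul_add, factorial_prime_mul hp, factorial_prime_mul hp, factorial_prime_mul hp, ← h2] at h1
  have h3 : 0 < p ^ (i + j) * (i.factorial * j.factorial) := by positivity
  apply Nat.eq_of_mul_eq_mul_left h3
  have h4 : (p * (i + j)).choose (p * i) = (p * (i + j)).choose (p * j) :=
    Nat.choose_symm_of_eq_add (mul_add p i j)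
  rw [h4, Nat.choose_symm_add]
  rw [pow_add] at *
  linarith

section

variable (p : ℕ) [Fact p.Prime]

/-- The ratio `∏ (l + p τ) / (p - 1)!` over `1 ≤ l < p`. -/
noncomputable def prodRatio (τ : ℕ) : ℤ_[p] :=
  ((∏ l ∈ Icc 1 (p - 1), (l + p * τ) : ℕ) : ℤ_[p]) * ((p - 1).factorial : ℤ_[p]).inv

variable {p}

theorem factorial_mul_inv :
    ((p - 1).factorial : ℤ_[p]) * ((p - 1).factorial : ℤ_[p]).inv = 1 :=
  PadicInt.mul_inv (PadicInt.norm_natCast_eq_one_iff.2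
    ((Nat.Prime.coprime_iff_not_dvd Fact.out).2 (by
      rw [(Fact.out : p.Prime).dvd_factorial]
      have := (Fact.out : p.Prime).pos
      omega)))

theorem cast_prod_eq_mul_prodRatio (τ : ℕ) :
    ((∏ l ∈ Icc 1 (p - 1), (l + p * τ) : ℕ) : ℤ_[p]) =
      (p - 1).factorial * prodRatio p τ := by
  rw [prodRatio, mul_left_comm, factorial_mul_inv, mul_one]

theorem prodRatio_zero : prodRatio p 0 = 1 := by
  rw [prodRatio]
  simp only [mul_zero, add_zero]
  rw [prod_Icc_eq_factorial, factorial_mul_inv]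

theorem choose_prime_mul_mul_prod_prodRatio (i j : ℕ) :
    ((p * (i + j)).choose (p * i) : ℤ_[p]) * ((∏ τ ∈ range i, prodRatio p τ) *
      ∏ τ ∈ range j, prodRatio p τ) =
      (i + j).choose i * ∏ τ ∈ range (i + j), prodRatio p τ := by
  have h := congrArg (Nat.cast (R := ℤ_[p]))
    (choose_prime_mul_mul_prod (Fact.out : p.Prime).pos i j)
  rw [Nat.cast_mul, Nat.cast_mul, Nat.cast_mul, Nat.cast_prod, Nat.cast_prod, Nat.cast_prod] at h
  simp only [cast_prod_eq_mul_prodRatio, prod_mul_distrib, prod_const, card_range] at h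
  have h0 : ((p - 1).factorial : ℤ_[p]) ^ (i + j) ≠ 0 :=
    pow_ne_zero _ (by exact_mod_cast Nat.factorial_ne_zero _)
  apply mul_left_cancel₀ h0
  rw [pow_add] at *
  linear_combination h

/-- `prodRatio p τ` is a polynomial in `τ (τ + 1)`, of degree two modulo `p ^ 7`. -/
theorem exists_prodRatio_expansion (hp : 11 ≤ p) : ∃ x y : ℤ_[p], ∀ τ : ℕ,
    (p : ℤ_[p]) ^ 7 ∣ prodRatio p τ - (1 + p ^ 3 * x * (τ * (τ + 1)) +
      p ^ 5 * y * (τ * (τ + 1)) ^ 2) := by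
  have hodd : Odd p := (Fact.out : p.Prime).odd_of_ne_two (by omega)
  obtain ⟨a, ha⟩ := dvd_coeff_pairProd hp (k := 1) (by norm_num) (by norm_num)
  obtain ⟨b, hb⟩ := dvd_coeff_pairProd hp (k := 2) (by norm_num) (by norm_num)
  obtain ⟨c, hc⟩ := dvd_coeff_pairProd hp (k := 3) (by norm_num) (by norm_num)
  set N := pairProd p with hN
  have key : ∀ z : ℤ, ∃ d : ℤ, N.eval z = N.coeff 0 + z * N.coeff 1 + z ^ 2 * N.coeff 2 +
      z ^ 3 * N.coeff 3 + z ^ 4 * d := by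
    intro z
    refine ⟨N.divX.divX.divX.divX.eval z, ?_⟩
    have h : ∀ P : Polynomial ℤ, P.eval z = P.coeff 0 + z * P.divX.eval z := by
      intro P
      conv_lhs => rw [← Polynomial.divX_mul_X_add P]
      simp
      ring
    rw [h N, h N.divX, h N.divX.divX, h N.divX.divX.divX]
    simp only [Polynomial.coeff_divX]
    ring
  set v := ((p - 1).factorial : ℤ_[p]).inv with hv
  have h0 : ((N.coeff 0 : ℤ) : ℤ_[p]) * v = 1 := by
    have h1 := prod_add_mul_eq_eval_pairProd hodd 0
    simp only [mul_zero, add_zero, Nat.cast_zero, zero_mul] at h1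
    rw [prod_Icc_eq_factorial, ← Polynomial.coeff_zero_eq_eval_zero, ← hN] at h1
    rw [← h1, Int.cast_natCast]
    exact factorial_mul_inv
  -- With `w = τ (τ + 1)`, the term `z³` at `z = p² w` contributes `p⁶ · p c`, and the rest `p⁸`.
  refine ⟨a * v, b * v, fun τ => ?_⟩
  obtain ⟨d, hd⟩ := key ((p : ℤ) ^ 2 * (τ * (τ + 1)))
  rw [← prod_add_mul_eq_eval_pairProd hodd τ, ha, hb, hc] at hd
  have hd' := congrArg (Int.cast (R := ℤ_[p])) hd
  rw [Int.cast_natCast] at hd'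
  rw [prodRatio, hd', ← hv]
  refine ⟨(c * (τ * (τ + 1)) ^ 3 + p * (τ * (τ + 1)) ^ 4 * d) * v, ?_⟩
  push_cast
  linear_combination h0

end

/-! ### The case `r = 1`: the Frobenius quotient -/

theorem multisection_one_sub_X_pow {p : ℕ} (hp : Odd p) {R : Type*} [CommRing R] (t : ℕ) :
    multisection p (((1 - X) ^ p) ^ t : R⟦X⟧) =
      ∑ i ∈ range (t + 1), C ((-1) ^ i * ((p * t).choose (p * i) : R)) * X ^ i := by
  ext n
  rw [← pow_mul, coeff_multisection, coeff_one_sub_X_pow, map_sum]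
  simp only [coeff_C_mul, coeff_X_pow, mul_ite, mul_one, mul_zero]
  rw [sum_ite_eq (range (t + 1)) n, mul_comm n p, pow_mul, hp.neg_one_pow]
  split_ifs with h
  · rfl
  · rw [mem_range, not_lt] at h
    rw [Nat.choose_eq_zero_of_lt]
    · simp
    · exact Nat.mul_lt_mul_of_pos_left h hp.pos

/-- Binomial expansion of `((1 - X ^ p) - Y) ^ n`, followed by multisection. -/
theorem multisection_sub_pow {p : ℕ} (hp : 0 < p) {R : Type*} [CommRing R] (Y : R⟦X⟧) (n : ℕ) :
    multisection p ((1 - X ^ p - Y) ^ n) =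
      ∑ t ∈ range (n + 1), (-1) ^ t * (n.choose t : R⟦X⟧) *
        ((1 - X) ^ (n - t) * multisection p (Y ^ t)) := by
  rw [sub_eq_neg_add, add_pow, map_sum]
  refine sum_congr rfl fun t _ => ?_
  rw [← multisection_one_sub_X_pow_mul hp]
  rw [show (-1 : R⟦X⟧) ^ t * (n.choose t : R⟦X⟧) = C ((-1) ^ t * (n.choose t : R)) by simp,
    ← multisection_C_mul]
  congr 1
  rw [neg_pow]
  simp
  ring

/-- The quotient `(1 - Xᵖ - (1 - X)ᵖ) / p`, with its coefficients `(-1) ^ (l + 1) (p choose l) / p`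
written as `(-1) ^ (l + 1) (p - 1 choose l - 1) / l`. -/
noncomputable def frobQuot (p : ℕ) [Fact p.Prime] : ℤ_[p]⟦X⟧ :=
  mk fun l => if l < p then (-1) ^ (l + 1) * ((p - 1).choose (l - 1) : ℤ_[p]) * recip p l else 0

section

variable {p : ℕ} [Fact p.Prime]

theorem C_mul_frobQuot (hp : Odd p) :
    C (p : ℤ_[p]) * frobQuot p = 1 - X ^ p - (1 - X) ^ p := by
  have hp1 : 1 < p := (Fact.out : p.Prime).one_lt
  ext n
  rw [coeff_C_mul, map_sub, map_sub, coeff_one_sub_X_pow, coeff_one, coeff_X_pow, frobQuot,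
    coeff_mk]
  rcases Nat.eq_zero_or_pos n with rfl | hn
  · simp [recip_of_dvd, hp.pos.ne]
  rcases lt_trichotomy n p with h | h | h
  · have h1 := cast_mul_recip (p := p) (Nat.not_dvd_of_pos_of_lt hn h)
    have h2 := Nat.add_one_mul_choose_eq (p - 1) (n - 1)
    rw [Nat.sub_add_cancel hp1.le, Nat.sub_add_cancel hn] at h2
    have h3 := congrArg (Nat.cast (R := ℤ_[p])) h2
    push_cast at h3
    rw [if_pos h, if_neg hn.ne', if_neg h.ne]
    linear_combination (-1) ^ (n + 1) * recip p n * h3 - (-1) ^ n * (p.choose n) * h1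
  · subst h
    simp [hn.ne', hp.neg_one_pow]
  · simp [h.not_gt, hn.ne', h.ne', Nat.choose_eq_zero_of_lt h]

theorem choose_pred_prime_zmod {k : ℕ} (hk : k < p) :
    ((p - 1).choose k : ZMod p) = (-1) ^ k := by
  induction k with
  | zero => simp
  | succ k ih =>
    have h1 := Nat.choose_succ_succ (p - 1) k
    rw [Nat.succ_eq_add_one, Nat.sub_add_cancel (Fact.out : p.Prime).one_le] at h1
    have h2 : ((p.choose (k + 1) : ℕ) : ZMod p) = 0 :=
      (ZMod.natCast_eq_zero_iff _ _).2 ((Fact.out : p.Prime).dvd_choose_self (by omega) hk)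
    rw [h1, Nat.cast_add, ih (by omega)] at h2
    rw [pow_succ]
    linear_combination h2

theorem toZMod_eq_zero_iff (a : ℤ_[p]) : PadicInt.toZMod a = 0 ↔ (p : ℤ_[p]) ∣ a := by
  rw [← RingHom.mem_ker, PadicInt.ker_toZMod, PadicInt.maximalIdeal_eq_span_p,
    Ideal.mem_span_singleton]

theorem toZModPow_eq_zero_iff (n : ℕ) (a : ℤ_[p]) :
    PadicInt.toZModPow n a = 0 ↔ (p : ℤ_[p]) ^ n ∣ a := by
  rw [← RingHom.mem_ker, PadicInt.ker_toZModPow, Ideal.mem_span_singleton]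

theorem C_dvd_frobQuot_sub_recipPoly : C (p : ℤ_[p]) ∣ frobQuot p - recipPoly p p := by
  rw [C_dvd_iff_forall_dvd_coeff]
  intro n
  rw [map_sub, frobQuot, coeff_mk, recipPoly, Polynomial.coeff_coe, coeff_trunc, recipSeries,
    coeff_mk]
  split_ifs with h
  · rcases n with _ | n
    · simp [recip_of_dvd]
    · rw [← toZMod_eq_zero_iff]
      simp only [map_sub, map_mul, map_pow, map_neg, map_one, map_natCast, Nat.add_sub_cancel]
      rw [choose_pred_prime_zmod (by omega), ← pow_add, Even.neg_one_pow ⟨n + 1, by ring⟩]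
      simp
  · simp

/-- The coefficients at multiples of `p` of a power of `frobQuot p` are, up to a power of `p`,
combinations of the binomial coefficients `(pt choose pi)`. -/
theorem C_pow_mul_multisection_frobQuot_pow (hp : Odd p) (n : ℕ) :
    C ((p : ℤ_[p]) ^ n) * multisection p (frobQuot p ^ n) =
      ∑ t ∈ range (n + 1), (-1) ^ t * (n.choose t : ℤ_[p]⟦X⟧) * ((1 - X) ^ (n - t) *
        ∑ i ∈ range (t + 1), C ((-1) ^ i * ((p * t).choose (p * i) : ℤ_[p])) * X ^ i) := by
  simp only [← multisection_one_sub_X_pow hp]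
  rw [← multisection_C_mul, map_pow, ← mul_pow, C_mul_frobQuot hp, multisection_sub_pow hp.pos]

theorem prodRatio_ne_zero (τ : ℕ) : prodRatio p τ ≠ 0 := by
  intro h
  have h1 := cast_prod_eq_mul_prodRatio (p := p) τ
  rw [h, mul_zero, Nat.cast_eq_zero, prod_eq_zero_iff] at h1
  obtain ⟨l, hl, h2⟩ := h1
  rw [mem_Icc] at hl
  omega

theorem choose_prime_mul_succ (n : ℕ) :
    ((p * (n + 1)).choose p : ℤ_[p]) = (n + 1) * prodRatio p n := by
  have h := choose_prime_mul_mul_prod_prodRatio (p := p) 1 n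
  rw [prod_range_one, prodRatio_zero, one_mul, add_comm 1 n, prod_range_succ,
    Nat.choose_one_right, mul_one] at h
  have hu : ∏ τ ∈ range n, prodRatio p τ ≠ 0 :=
    prod_ne_zero_iff.2 fun τ _ => prodRatio_ne_zero τ
  apply mul_right_cancel₀ hu
  rw [h]
  push_cast
  ring

/-- The coefficient of `Xᵖ` in the cube, in terms of the first coefficient in the expansion of
`prodRatio`. -/
theorem dvd_coeff_frobQuot_pow_three_sub (hp : Odd p) {x y : ℤ_[p]}
    (h : ∀ τ : ℕ, (p : ℤ_[p]) ^ 7 ∣ prodRatio p τ - (1 + p ^ 3 * x * (τ * (τ + 1)) +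
      p ^ 5 * y * (τ * (τ + 1)) ^ 2)) :
    (p : ℤ_[p]) ∣ coeff p (frobQuot p ^ 3) - 6 * x := by
  have hp0 : (p : ℤ_[p]) ≠ 0 := by exact_mod_cast (Fact.out : p.Prime).ne_zero
  have h2 := choose_prime_mul_succ (p := p) 1
  have h3 := choose_prime_mul_succ (p := p) 2
  norm_num at h2 h3
  have key := congrArg (coeff 1) (C_pow_mul_multisection_frobQuot_pow hp 3)
  rw [coeff_C_mul, coeff_multisection, one_mul] at key
  obtain ⟨d1, hd1⟩ := h 1
  obtain ⟨d2, hd2⟩ := h 2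
  have key2 : (p : ℤ_[p]) ^ 3 * coeff p (frobQuot p ^ 3) =
      3 - 3 * (p * 2).choose p + (p * 3).choose p := by
    have e1 : coeff 1 ((1 - X : ℤ_[p]⟦X⟧) ^ 3) = -3 := by rw [coeff_one_sub_X_pow]; simp
    have e2 : coeff 1 ((1 - X : ℤ_[p]⟦X⟧) ^ 2) = -2 := by rw [coeff_one_sub_X_pow]; simp
    have e3 : coeff 1 (3 : ℤ_[p]⟦X⟧) = 0 := by
      rw [← map_ofNat C 3, coeff_C, if_neg one_ne_zero]
    have e4 : constantCoeff (3 : ℤ_[p]⟦X⟧) = 3 := map_ofNat _ 3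
    have e5 : coeff 1 ((-1 : ℤ_[p]⟦X⟧) ^ 3) = 0 := by
      rw [Odd.neg_one_pow (by decide), map_neg, coeff_one, if_neg one_ne_zero, neg_zero]
    rw [key]
    simp [sum_range_succ, Nat.choose_succ_succ, e1, e2, e3, e4, e5, coeff_one_mul]
    ring
  refine ⟨84 * p * y + p ^ 3 * (3 * d2 - 6 * d1), ?_⟩
  apply mul_left_cancel₀ (pow_ne_zero 3 hp0)
  rw [mul_sub, key2, h2, h3]
  push_cast at hd1 hd2
  linear_combination 3 * hd2 - 6 * hd1

/-- The binomial coefficients `(pt choose pi)`, `t ≤ 6`, in a ring in which the first-order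
parameter `x` satisfies `x³ = 0` and `y` only enters linearly. -/
theorem choose_eq_of_nilpotent {A : Type*} [CommRing A] {x y : A} (hx : x ^ 3 = 0) (hxy : x * y = 0)
    (hy : y ^ 2 = 0) (e : ℕ → A)
    (he : ∀ τ : ℕ, e τ = 1 + x * (τ * (τ + 1)) + y * (τ * (τ + 1)) ^ 2) (b : ℕ → ℕ → A)
    (hb : ∀ i j, b (i + j) i * ((∏ τ ∈ range i, e τ) * ∏ τ ∈ range j, e τ) =
      (i + j).choose i * ∏ τ ∈ range (i + j), e τ) :
    b 4 2 = 6 * (1 + 16 * x + 176 * y + 40 * x ^ 2) ∧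
    b 5 2 = 10 * (1 + 30 * x + 540 * y + 180 * x ^ 2) ∧
    b 6 2 = 15 * (1 + 48 * x + 1296 * y + 504 * x ^ 2) ∧
    b 6 3 = 20 * (1 + 54 * x + 1404 * y + 756 * x ^ 2) := by
  have mul_T : ∀ a b c a' b' c' : A, (1 + a * x + b * y + c * x ^ 2) *
      (1 + a' * x + b' * y + c' * x ^ 2) =
      1 + (a + a') * x + (b + b') * y + (c + c' + a * a') * x ^ 2 := by
    intro a b c a' b' c'
    linear_combination (a * c' + c * a' + c * c' * x) * hx +
      (a * b' + b * a' + b * c' * x + c * b' * x) * hxy + b * b' * hy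
  have he' : ∀ τ : ℕ, e τ = 1 + (τ * (τ + 1) : A) * x + ((τ * (τ + 1)) ^ 2 : A) * y
      + 0 * x ^ 2 := fun τ => by rw [he]; ring
  -- Cancel the unit `1 + a x + b y + c x²`, whose inverse is `1 - a x - b y + (a² - c) x²`.
  have cancel : ∀ a b c u v : A, u * (1 + a * x + b * y + c * x ^ 2) = v →
      u = v * (1 + (-a) * x + (-b) * y + (a ^ 2 - c) * x ^ 2) := by
    intro a b c u v h
    rw [← h, mul_assoc, mul_T]
    ring
  have h42 := hb 2 2
  have h52 := hb 2 3
  have h62 := hb 2 4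
  have h63 := hb 3 3
  simp only [prod_range_succ, prod_range_zero, one_mul, he', mul_T] at h42 h52 h62 h63
  refine ⟨?_, ?_, ?_, ?_⟩
  · rw [cancel _ _ _ _ _ h42, mul_assoc, mul_T]
    norm_num [Nat.choose_succ_succ]
  · rw [cancel _ _ _ _ _ h52, mul_assoc, mul_T]
    norm_num [Nat.choose_succ_succ]
  · rw [cancel _ _ _ _ _ h62, mul_assoc, mul_T]
    norm_num [Nat.choose_succ_succ]
  · rw [cancel _ _ _ _ _ h63, mul_assoc, mul_T]
    norm_num [Nat.choose_succ_succ]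

/-- The sixth power modulo `p`, in terms of the first coefficient in the expansion of
`prodRatio`. -/
theorem C_dvd_multisection_frobQuot_pow_six_sub (hp : Odd p) {x y : ℤ_[p]}
    (h : ∀ τ : ℕ, (p : ℤ_[p]) ^ 7 ∣ prodRatio p τ - (1 + p ^ 3 * x * (τ * (τ + 1)) +
      p ^ 5 * y * (τ * (τ + 1)) ^ 2)) :
    C (p : ℤ_[p]) ∣ multisection p (frobQuot p ^ 6) - C (360 * x ^ 2) * (X ^ 2 * (1 - X) ^ 2) := by
  have hp0 : (p : ℤ_[p]) ≠ 0 := by exact_mod_cast (Fact.out : p.Prime).ne_zero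
  -- The powers of `p` cleared from `frobQuot p ^ 6` make this a computation in `ZMod (p ^ 7)`.
  set φ : ℤ_[p] →+* ZMod (p ^ 7) := PadicInt.toZModPow 7 with hφ
  have hφ0 : ∀ a : ℤ_[p], φ (p ^ 7 * a) = 0 := fun a =>
    (toZModPow_eq_zero_iff 7 _).2 (Dvd.intro _ rfl)
  set x' := φ (p ^ 3 * x) with hx'
  set y' := φ (p ^ 5 * y) with hy'
  set e : ℕ → ZMod (p ^ 7) := fun τ => φ (prodRatio p τ) with he_def
  set b : ℕ → ℕ → ZMod (p ^ 7) := fun t i => ((p * t).choose (p * i) : ZMod (p ^ 7)) with hb_def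
  have he : ∀ τ : ℕ, e τ = 1 + x' * (τ * (τ + 1)) + y' * (τ * (τ + 1)) ^ 2 := by
    intro τ
    have h1 := (toZModPow_eq_zero_iff 7 _).2 (h τ)
    rw [← hφ, map_sub, sub_eq_zero] at h1
    simp only [he_def, h1, hx', hy', map_add, map_mul, map_pow, map_natCast, map_one]
  have hb : ∀ i j, b (i + j) i * ((∏ τ ∈ range i, e τ) * ∏ τ ∈ range j, e τ) =
      (i + j).choose i * ∏ τ ∈ range (i + j), e τ := by
    intro i j
    have h1 := congrArg φ (choose_prime_mul_mul_prod_prodRatio (p := p) i j)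
    simpa using h1
  have hb1 : ∀ n, b (n + 1) 1 = (n + 1) * e n := by
    intro n
    have h1 := congrArg φ (choose_prime_mul_succ (p := p) n)
    simpa [hb_def] using h1
  obtain ⟨h42, h52, h62, h63⟩ := choose_eq_of_nilpotent (x := x') (y := y')
    (by rw [hx', ← map_pow, ← hφ0 (p ^ 2 * x ^ 3)]; congr 1; ring)
    (by rw [hx', hy', ← map_mul, ← hφ0 (p * x * y)]; congr 1; ring)
    (by rw [hy', ← map_pow, ← hφ0 (p ^ 3 * y ^ 2)]; congr 1; ring) e he b hb
  have hsymm : ∀ t i j, i + j = t → b t i = b t j := by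
    intro t i j hij
    simp only [hb_def]
    rw [Nat.choose_symm_of_eq_add]
    rw [← hij, mul_add]
  have hb0 : ∀ t, b t 0 = 1 := by simp [hb_def]
  have key := congrArg (PowerSeries.map φ) (C_pow_mul_multisection_frobQuot_pow hp 6)
  simp only [map_sum, map_mul, map_pow, map_neg, map_one, map_natCast, map_sub, map_X]
    at key
  have hbb : ∀ t i, ((p * t).choose (p * i) : (ZMod (p ^ 7))⟦X⟧) = C (b t i) := by
    simp [hb_def]
  simp only [hbb] at key
  have goal1 : C ((p : ℤ_[p]) ^ 7) ∣ C ((p : ℤ_[p]) ^ 6) * multisection p (frobQuot p ^ 6) -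
      C (360 * (p ^ 3 * x) ^ 2) * (X ^ 2 * (1 - X) ^ 2) := by
    rw [C_dvd_iff_forall_dvd_coeff]
    intro n
    rw [← toZModPow_eq_zero_iff, ← hφ, ← coeff_map]
    have : PowerSeries.map φ (C ((p : ℤ_[p]) ^ 6) * multisection p (frobQuot p ^ 6) -
      C (360 * (p ^ 3 * x) ^ 2) * (X ^ 2 * (1 - X) ^ 2)) = 0 := by
      simp only [map_mul, map_sub, map_pow, map_C, map_X, map_one, map_natCast, map_ofNat]
      have hCx : (p : (ZMod (p ^ 7))⟦X⟧) ^ 3 * C (φ x) = C x' := by simp [hx']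
      rw [key, hCx]
      simp only [sum_range_succ, sum_range_zero]
      rw [hsymm 6 4 2 rfl, hsymm 6 5 1 rfl, hsymm 6 6 0 rfl, hsymm 5 3 2 rfl, hsymm 5 4 1 rfl,
        hsymm 5 5 0 rfl, hsymm 4 3 1 rfl, hsymm 4 4 0 rfl, hsymm 3 2 1 rfl, hsymm 3 3 0 rfl,
        hsymm 2 2 0 rfl, hsymm 1 1 0 rfl, h42, h52, h62, h63, hb1 1, hb1 2, hb1 3, hb1 4, hb1 5]
      simp only [hb0, he, map_add, map_mul, map_pow, map_natCast, map_one, map_ofNat]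
      simp [Nat.choose_succ_succ]
      ring
    rw [this, map_zero]
  obtain ⟨Q, hQ⟩ := goal1
  refine ⟨Q, ?_⟩
  have hC : C ((p : ℤ_[p]) ^ 6) ≠ 0 := by
    rw [Ne, map_eq_zero_iff C C_injective]
    exact pow_ne_zero 6 hp0
  apply mul_left_cancel₀ hC
  have hC7 : C ((p : ℤ_[p]) ^ 7) = C ((p : ℤ_[p]) ^ 6) * C (p : ℤ_[p]) := by
    rw [pow_succ, map_mul]
  rw [hC7, mul_assoc] at hQ
  rw [← hQ]
  simp only [map_mul, map_pow]
  ring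

end

/-! ### The cube and the Bernoulli number modulo `p` -/

section

variable {p : ℕ} [Fact p.Prime]

theorem norm_natCast_of_lt {n : ℕ} (h0 : 0 < n) (h : n < p) : ‖(n : ℚ_[p])‖ = 1 :=
  Padic.norm_natCast_eq_one_iff.2
    ((Nat.Prime.coprime_iff_not_dvd Fact.out).2 (Nat.not_dvd_of_pos_of_lt h0 h))

theorem norm_natCast_le_one (n : ℕ) : ‖(n : ℚ_[p])‖ ≤ 1 := by
  exact_mod_cast Padic.norm_int_le_one (p := p) n

/-- The recursion for `bernoulli n` divides only by `n + 1 < p`. -/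
theorem norm_bernoulli_le_one {n : ℕ} (hn : n + 1 < p) : ‖((bernoulli n : ℚ) : ℚ_[p])‖ ≤ 1 := by
  induction n using Nat.strong_induction_on with
  | _ n ih =>
    have h := congrArg (Rat.cast (K := ℚ_[p])) (sum_bernoulli (n + 1))
    rw [sum_range_succ] at h
    push_cast at h
    rw [Nat.choose_succ_self_right] at h
    have h1 : ((n + 1 : ℕ) : ℚ_[p]) * (bernoulli n : ℚ) = ((if n + 1 = 1 then 1 else 0 : ℕ) : ℚ_[p])
        - ∑ k ∈ range n, ((n + 1).choose k : ℚ_[p]) * (bernoulli k : ℚ) := by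
      rw [eq_sub_iff_add_eq, add_comm, h]
      by_cases hn0 : n = 0 <;> simp [hn0]
    have h2 := congrArg norm h1
    rw [norm_mul, norm_natCast_of_lt (by omega) hn, one_mul] at h2
    rw [h2, sub_eq_add_neg]
    refine (Padic.nonarchimedean _ _).trans (max_le ?_ ?_)
    · exact norm_natCast_le_one _
    · rw [norm_neg]
      refine IsUltrametricDist.norm_sum_le_of_forall_le_of_nonneg zero_le_one fun k hk => ?_
      rw [mem_range] at hk
      rw [norm_mul]
      exact mul_le_one₀ (norm_natCast_le_one _) (norm_nonneg _) (ih k hk (by omega))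

/-- The Bernoulli numbers of index at most `p - 2` are `p`-integral. -/
theorem exists_padicInt_bernoulli (p : ℕ) [Fact p.Prime] : ∃ b : ℕ → ℤ_[p], ∀ n, n + 1 < p →
    (b n : ℚ_[p]) = (bernoulli n : ℚ) := by
  refine ⟨fun n => if h : n + 1 < p then ⟨(bernoulli n : ℚ), norm_bernoulli_le_one h⟩ else 0, ?_⟩
  intro n hn
  simp [hn]

/-- Faulhaber's formula for the exponent `p - 2`, modulo `p`. -/
theorem neg_sum_range_pow_zmod (hp : 3 ≤ p) {b : ℕ → ℤ_[p]} (hb : ∀ n, n + 1 < p →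
    (b n : ℚ_[p]) = (bernoulli n : ℚ)) (n : ℕ) :
    -∑ k ∈ range n, (k : ZMod p) ^ (p - 2) = ∑ i ∈ range (p - 1),
      PadicInt.toZMod (b i) * ((p - 1).choose i : ZMod p) * (n : ZMod p) ^ (p - 1 - i) := by
  have h1 : ((p - 1 : ℕ) : ℚ) * ∑ k ∈ range n, (k : ℚ) ^ (p - 2) = ∑ i ∈ range (p - 1),
      bernoulli i * ((p - 1).choose i : ℚ) * (n : ℚ) ^ (p - 1 - i) := by
    rw [sum_range_pow, show p - 2 + 1 = p - 1 by omega, mul_sum]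
    refine sum_congr rfl fun i _ => ?_
    have e : ((p - 2 : ℕ) : ℚ) + 1 = ((p - 1 : ℕ) : ℚ) := by
      rw [← Nat.cast_succ]; congr 1; omega
    rw [e]
    have h0 : ((p - 1 : ℕ) : ℚ) ≠ 0 := by
      rw [Nat.cast_ne_zero]; omega
    field_simp
  have h2 : ((p - 1 : ℕ) : ℤ_[p]) * ∑ k ∈ range n, (k : ℤ_[p]) ^ (p - 2) = ∑ i ∈ range (p - 1),
      b i * ((p - 1).choose i : ℤ_[p]) * (n : ℤ_[p]) ^ (p - 1 - i) := by
    apply PadicInt.ext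
    have h3 := congrArg (Rat.cast (K := ℚ_[p])) h1
    push_cast at h3
    rw [PadicInt.coe_mul, PadicInt.coe_sum, PadicInt.coe_sum]
    push_cast
    rw [h3]
    refine sum_congr rfl fun i hi => ?_
    rw [mem_range] at hi
    rw [hb i (by omega)]
  have h3 := congrArg (PadicInt.toZMod (p := p)) h2
  have e : ((p - 1 : ℕ) : ZMod p) = -1 := by
    rw [Nat.cast_sub (by omega)]; simp
  simpa [e] using h3

theorem sum_range_pow_zmod_of_lt {m : ℕ} (hm : m < p - 1) :
    ∑ n ∈ range p, (n : ZMod p) ^ m = 0 := by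
  rw [sum_range_cast_zmod p (fun a => a ^ m)]
  exact FiniteField.sum_pow_lt_card_sub_one (ZMod p) m (by rwa [ZMod.card])

theorem sum_range_pow_pred_zmod : ∑ n ∈ range p, (n : ZMod p) ^ (p - 1) = -1 := by
  have hp1 : 1 < p := (Fact.out : p.Prime).one_lt
  rw [sum_range_cast_zmod p (fun a => a ^ (p - 1))]
  have h : ∀ a : ZMod p, a ^ (p - 1) = 1 - if a = 0 then 1 else 0 := by
    intro a
    split_ifs with h
    · rw [h, zero_pow (by omega), sub_self]
    · rw [ZMod.pow_card_sub_one_eq_one h, sub_zero]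
  simp [h, sum_sub_distrib, ZMod.card]

theorem inv_sq_eq_pow_zmod (hp : 4 ≤ p) (a : ZMod p) : a⁻¹ * a⁻¹ = a ^ (p - 3) := by
  by_cases h : a = 0
  · rw [h, zero_pow (by omega)]; simp
  · have h1 := ZMod.pow_card_sub_one_eq_one h
    rw [show p - 1 = p - 3 + 1 + 1 by omega, pow_succ, pow_succ] at h1
    field_simp
    linear_combination -h1

theorem inv_eq_pow_zmod (hp : 3 ≤ p) (a : ZMod p) : a⁻¹ = a ^ (p - 2) := by
  by_cases h : a = 0
  · rw [h, zero_pow (by omega)]; simp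
  · have h1 := ZMod.pow_card_sub_one_eq_one h
    rw [show p - 1 = p - 2 + 1 by omega, pow_succ] at h1
    field_simp
    linear_combination -h1

/-- The double sum `∑ 1 / (i n²)` over `i < n < p` is the Bernoulli number of index `p - 3`
modulo `p`. -/
theorem sum_inv_sq_mul_sum_inv (hp : 5 ≤ p) {b : ℕ → ℤ_[p]} (hb : ∀ n, n + 1 < p →
    (b n : ℚ_[p]) = (bernoulli n : ℚ)) :
    ∑ n ∈ range p, (n : ZMod p)⁻¹ * (n : ZMod p)⁻¹ * ∑ i ∈ range n, (i : ZMod p)⁻¹ =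
      PadicInt.toZMod (b (p - 3)) := by
  have h1 : ∀ n : ℕ, (n : ZMod p)⁻¹ * (n : ZMod p)⁻¹ * ∑ i ∈ range n, (i : ZMod p)⁻¹ =
      -∑ i ∈ range (p - 1), PadicInt.toZMod (b i) * ((p - 1).choose i : ZMod p) *
        (n : ZMod p) ^ (2 * p - 4 - i) := by
    intro n
    rw [inv_sq_eq_pow_zmod (show 4 ≤ p by omega)]
    simp only [inv_eq_pow_zmod (show 3 ≤ p by omega)]
    have h2 := neg_sum_range_pow_zmod (show 3 ≤ p by omega) hb n
    rw [← neg_neg (∑ k ∈ range n, _), h2, mul_neg, mul_sum]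
    congr 1
    refine sum_congr rfl fun i hi => ?_
    rw [mem_range] at hi
    rw [show 2 * p - 4 - i = (p - 3) + (p - 1 - i) by omega, pow_add]
    ring
  simp only [h1]
  -- The exponents `2p - 4 - i` lie between `p - 2` and `2p - 4`; the only multiple of `p - 1` among
  -- them is `p - 1` itself, for `i = p - 3`.
  rw [sum_neg_distrib, sum_comm, sum_eq_single (p - 3)]
  · rw [← mul_sum, show 2 * p - 4 - (p - 3) = p - 1 by omega, sum_range_pow_pred_zmod,
      choose_pred_prime_zmod (by omega)]
    have he : Even (p - 3) := by
      have := (Fact.out : p.Prime).odd_of_ne_two (by omega)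
      exact Nat.Odd.sub_odd this (by decide)
    rw [he.neg_one_pow]
    ring
  · intro i hi hi'
    rw [mem_range] at hi
    rw [← mul_sum]
    rcases lt_or_gt_of_ne hi' with h | h
    · have h3 : ∀ n : ℕ, (n : ZMod p) ^ (2 * p - 4 - i) = (n : ZMod p) ^ (p - 3 - i) := by
        intro n
        rw [show 2 * p - 4 - i = p + (p - 4 - i) by omega, pow_add, ZMod.pow_card, ← pow_succ',
          show p - 4 - i + 1 = p - 3 - i by omega]
      simp only [h3]
      rw [sum_range_pow_zmod_of_lt (by omega), mul_zero]
    · rw [sum_range_pow_zmod_of_lt (by omega), mul_zero]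
  · intro h
    rw [mem_range] at h
    omega

theorem toZMod_recip (l : ℕ) : PadicInt.toZMod (recip p l) = (l : ZMod p)⁻¹ := by
  by_cases h : p ∣ l
  · rw [recip_of_dvd h, (ZMod.natCast_eq_zero_iff _ _).2 h]
    simp
  · have h1 := congrArg (PadicInt.toZMod (p := p)) (cast_mul_recip h)
    rw [map_mul, map_natCast, map_one] at h1
    exact eq_inv_of_mul_eq_one_right h1

/-- The sum of the `1 / (i j)` over `i + j = k`, by partial fractions. -/
theorem coeff_map_recipPoly_sq {k : ℕ} (hk : k < p) :
    coeff k (PowerSeries.map PadicInt.toZMod (recipPoly p p) ^ 2) =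
      2 * (k : ZMod p)⁻¹ * ∑ i ∈ range k, (i : ZMod p)⁻¹ := by
  have h0 : ∀ l, l < p → coeff l (PowerSeries.map PadicInt.toZMod (recipPoly p p)) =
      (l : ZMod p)⁻¹ := by
    intro l hl
    rw [coeff_map, recipPoly, Polynomial.coeff_coe, coeff_trunc, if_pos hl, recipSeries, coeff_mk,
      toZMod_recip]
  rw [pow_two, coeff_mul, Nat.sum_antidiagonal_eq_sum_range_succ
    (fun i j => coeff i (PowerSeries.map PadicInt.toZMod (recipPoly p p)) *
      coeff j (PowerSeries.map PadicInt.toZMod (recipPoly p p)))]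
  have h1 : ∀ i ∈ range (k + 1), coeff i (PowerSeries.map PadicInt.toZMod (recipPoly p p)) *
      coeff (k - i) (PowerSeries.map PadicInt.toZMod (recipPoly p p)) =
      (i : ZMod p)⁻¹ * ((k - i : ℕ) : ZMod p)⁻¹ := by
    intro i hi
    rw [mem_range] at hi
    rw [h0 _ (by omega), h0 _ (by omega)]
  rw [sum_congr rfl h1]
  rcases k with _ | m
  · simp
  rw [sum_range_succ, sum_range_succ', sum_range_succ']
  have h2 : ∀ i ∈ range m, ((i + 1 : ℕ) : ZMod p)⁻¹ * ((m + 1 - (i + 1) : ℕ) : ZMod p)⁻¹ =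
      ((m + 1 : ℕ) : ZMod p)⁻¹ * (((i + 1 : ℕ) : ZMod p)⁻¹ + ((m - 1 - i + 1 : ℕ) : ZMod p)⁻¹) := by
    intro i hi
    rw [mem_range] at hi
    have e : m + 1 - (i + 1) = m - 1 - i + 1 := by omega
    have ne : ∀ n : ℕ, 0 < n → n < p → (n : ZMod p) ≠ 0 := fun n hn hn' => by
      rw [Ne, ZMod.natCast_eq_zero_iff]
      exact Nat.not_dvd_of_pos_of_lt hn hn'
    rw [e]
    have n1 := ne (i + 1) (by omega) (by omega)
    have n2 := ne (m - 1 - i + 1) (by omega) (by omega)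
    have n3 := ne (m + 1) (by omega) (by omega)
    have e2 : ((m + 1 : ℕ) : ZMod p) = ((i + 1 : ℕ) : ZMod p) + ((m - 1 - i + 1 : ℕ) : ZMod p) := by
      rw [← Nat.cast_add]; congr 1; omega
    field_simp
    rw [e2]
    ring
  rw [sum_congr rfl h2, ← mul_sum, sum_add_distrib,
    sum_range_reflect (fun j => ((j + 1 : ℕ) : ZMod p)⁻¹) m]
  simp
  ring

/-- The sum of the `1 / (i j l)` over `i + j + l = p`, modulo `p`. -/
theorem toZMod_coeff_recipPoly_pow_three (hp : 5 ≤ p) {b : ℕ → ℤ_[p]} (hb : ∀ n, n + 1 < p →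
    (b n : ℚ_[p]) = (bernoulli n : ℚ)) :
    PadicInt.toZMod (coeff p (recipPoly p p ^ 3)) = -2 * PadicInt.toZMod (b (p - 3)) := by
  rw [← coeff_map, map_pow, pow_succ, coeff_mul, Nat.sum_antidiagonal_eq_sum_range_succ
    (fun i j => coeff i (PowerSeries.map PadicInt.toZMod (recipPoly p p) ^ 2) *
      coeff j (PowerSeries.map PadicInt.toZMod (recipPoly p p))), sum_range_succ]
  have h0 : ∀ l, coeff l (PowerSeries.map PadicInt.toZMod (recipPoly p p)) =
      if l < p then (l : ZMod p)⁻¹ else 0 := by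
    intro l
    rw [coeff_map, recipPoly, Polynomial.coeff_coe, coeff_trunc, recipSeries, coeff_mk]
    split_ifs
    · rw [toZMod_recip]
    · simp
  rw [Nat.sub_self, h0 0]
  have h1 : ∀ k ∈ range p, coeff k (PowerSeries.map PadicInt.toZMod (recipPoly p p) ^ 2) *
      coeff (p - k) (PowerSeries.map PadicInt.toZMod (recipPoly p p)) =
      -2 * ((k : ZMod p)⁻¹ * (k : ZMod p)⁻¹ * ∑ i ∈ range k, (i : ZMod p)⁻¹) := by
    intro k hk
    rw [mem_range] at hk
    rw [coeff_map_recipPoly_sq hk, h0]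
    rcases Nat.eq_zero_or_pos k with rfl | hk0
    · simp
    · rw [if_pos (by omega), Nat.cast_sub hk.le]
      simp only [CharP.cast_eq_zero, zero_sub, inv_neg]
      ring
  rw [sum_congr rfl h1, ← mul_sum, sum_inv_sq_mul_sum_inv hp hb]
  simp

/-- The sixth power of `∑ Xˡ / l` over `0 < l < p`, modulo `p`. -/
theorem C_dvd_multisection_recipPoly_pow_six_sub (hp : 11 ≤ p) {b : ℕ → ℤ_[p]}
    (hb : ∀ n, n + 1 < p → (b n : ℚ_[p]) = (bernoulli n : ℚ)) :
    C (p : ℤ_[p]) ∣ multisection p (recipPoly p p ^ 6) -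
      C (40 * b (p - 3) ^ 2) * (X ^ 2 * (1 - X) ^ 2) := by
  have hodd : Odd p := (Fact.out : p.Prime).odd_of_ne_two (by omega)
  obtain ⟨x, y, h⟩ := exists_prodRatio_expansion hp
  have h1 := C_dvd_multisection_frobQuot_pow_six_sub hodd h
  have h2 := dvd_coeff_frobQuot_pow_three_sub hodd h
  have h3 : C (p : ℤ_[p]) ∣ frobQuot p ^ 6 - recipPoly p p ^ 6 :=
    C_dvd_frobQuot_sub_recipPoly.trans (sub_dvd_pow_sub_pow _ _ 6)
  have h4 : (p : ℤ_[p]) ∣ coeff p (frobQuot p ^ 3) - coeff p (recipPoly p p ^ 3) := by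
    rw [← map_sub]
    exact (C_dvd_iff_forall_dvd_coeff _ _).1
      (C_dvd_frobQuot_sub_recipPoly.trans (sub_dvd_pow_sub_pow _ _ 3)) p
  have h5 : (p : ℤ_[p]) ∣ 360 * x ^ 2 - 40 * b (p - 3) ^ 2 := by
    rw [← toZMod_eq_zero_iff] at h2 h4 ⊢
    rw [map_sub] at h2 h4
    rw [toZMod_coeff_recipPoly_pow_three (by omega) hb] at h4
    simp only [map_sub, map_mul, map_pow, map_ofNat] at *
    -- `360 x² - 40 B² = 40 (3x - B) (3x + B)`, and `6x ≡ -2B` by the two values of the cube.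
    linear_combination (-(60 * PadicInt.toZMod x - 20 * PadicInt.toZMod (b (p - 3)))) * (h2 - h4)
  have h6 := (h1.sub (C_dvd_multisection (q := p) h3)).add
    ((map_dvd C h5).mul_right (X ^ 2 * (1 - X) ^ 2))
  convert h6 using 1
  rw [map_sub, map_sub]
  ring

end

/-! ### Induction on `r` and passage to rational numbers -/

section

variable {p : ℕ} [Fact p.Prime]

theorem isUnit_natCast_of_lt {n : ℕ} (h0 : 0 < n) (h : n < p) : IsUnit (n : ℤ_[p]) :=
  PadicInt.isUnit_iff.2 (PadicInt.norm_natCast_eq_one_iff.2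
    ((Nat.Prime.coprime_iff_not_dvd Fact.out).2 (Nat.not_dvd_of_pos_of_lt h0 h)))

theorem coeff_X_pow_mul_one_sub_X_pow_eq_zero {R : Type*} [CommRing R] (c : R) {i j m : ℕ}
    (hm : ¬ (i ≤ m ∧ m ≤ i + j)) : coeff m (C c * (X ^ i * (1 - X) ^ j)) = 0 := by
  rw [coeff_C_mul, coeff_X_pow_mul']
  split_ifs with h
  · rw [coeff_one_sub_X_pow, Nat.choose_eq_zero_of_lt (by omega)]
    simp
  · simp

/-- The coefficients of the sixth power of `recipSeries p` at multiples of `p ^ 2`. -/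
theorem sq_dvd_coeff_recipSeries_pow_sub (hp : 11 ≤ p) {b : ℕ → ℤ_[p]}
    (hb : ∀ n, n + 1 < p → (b n : ℚ_[p]) = (bernoulli n : ℚ)) {a : ℤ_[p]}
    (ha : 3 * a = -20 * b (p - 3) ^ 2) (k : ℕ) :
    (p : ℤ_[p]) ^ 2 ∣ coeff (k * p ^ 2) (recipSeries p ^ 6) - p * (a * k) := by
  have h := dvd_coeff_recipSeries_pow_sub (p := p) (by omega) (r := 0)
    (s := C (40 * b (p - 3) ^ 2) * (X ^ 2 * (1 - X) ^ 2))
    (fun m hm => coeff_X_pow_mul_one_sub_X_pow_eq_zero _ (by omega))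
    (by simpa using C_dvd_multisection_recipPoly_pow_six_sub hp hb) k
  -- `X² (1 - X)² / (1 - X)⁶ = X² / (1 - X)⁴` has the coefficients `(n + 1 choose 3) = (n³ - n) / 6`;
  -- at `n = k p` only the linear term survives modulo `p²`.
  have e : geomSeries ℤ_[p] ^ 6 * (C (40 * b (p - 3) ^ 2) * (X ^ 2 * (1 - X) ^ 2)) =
      C (40 * b (p - 3) ^ 2) * (X ^ 2 * geomSeries ℤ_[p] ^ 4) := by
    linear_combination C (40 * b (p - 3) ^ 2) * X ^ 2 * geomSeries ℤ_[p] ^ 4 *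
      geomSeries_pow_mul_one_sub_pow (R := ℤ_[p]) 2
  rw [zero_add, pow_zero, one_mul, e, coeff_C_mul] at h
  have hc : 6 * coeff (k * p) (X ^ 2 * geomSeries ℤ_[p] ^ 4) =
      (((k * p : ℕ) : ℤ_[p]) + 1) * (k * p : ℕ) * ((k * p : ℕ) - 1) := by
    rw [coeff_X_pow_mul', mk_one_pow_eq_mk_choose_add, coeff_mk]
    generalize k * p = n
    split_ifs with h2
    · obtain ⟨m, rfl⟩ := Nat.exists_eq_add_of_le' h2
      have h3 := Nat.descFactorial_eq_factorial_mul_choose (3 + m) 3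
      simp only [Nat.descFactorial, Nat.factorial, Nat.sub_zero] at h3
      have h4 := congrArg (Nat.cast (R := ℤ_[p])) h3
      rw [show 3 + m - 2 = m + 1 by omega, show 3 + m - 1 = m + 2 by omega] at h4
      rw [show m + 2 - 2 = m by omega]
      push_cast at h4 ⊢
      linear_combination -h4
    · interval_cases n <;> simp
  have h6 : IsUnit (6 : ℤ_[p]) := by
    have := isUnit_natCast_of_lt (p := p) (n := 6) (by norm_num) (by omega)
    exact_mod_cast this
  rw [← h6.dvd_mul_left] at h ⊢
  have h7 := h.add (Dvd.intro (40 * b (p - 3) ^ 2 * k ^ 3 * p) rfl)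
  convert h7 using 1
  push_cast at hc
  linear_combination 40 * b (p - 3) ^ 2 * hc - 2 * p * k * ha

/-- At multiples of `p ^ r` with `r ≥ 2`, the coefficients of the sixth power of `recipSeries p`
depend linearly on the multiplier, modulo `p ^ r`. -/
theorem pow_dvd_coeff_recipSeries_pow_sub (hp : 11 ≤ p) {b : ℕ → ℤ_[p]}
    (hb : ∀ n, n + 1 < p → (b n : ℚ_[p]) = (bernoulli n : ℚ)) {a : ℤ_[p]}
    (ha : 3 * a = -20 * b (p - 3) ^ 2) (r k : ℕ) :
    (p : ℤ_[p]) ^ (r + 2) ∣ coeff (k * p ^ (r + 2)) (recipSeries p ^ 6) - p ^ (r + 1) * (a * k) := by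
  induction r generalizing k with
  | zero => simpa using sq_dvd_coeff_recipSeries_pow_sub hp hb ha k
  | succ r ih =>
    have hJ : ∀ n, coeff n (X * geomSeries ℤ_[p] ^ 2) = (n : ℤ_[p]) := by
      intro n
      rw [mk_one_pow_eq_mk_choose_add]
      rcases n with _ | n
      · simp
      · rw [mul_comm X, coeff_succ_mul_X, coeff_mk, Nat.choose_one_right]
        push_cast
        ring
    have h1 : C ((p : ℤ_[p]) ^ (r + 2)) ∣ multisection (p ^ (r + 2)) (recipSeries p ^ 6) -
        C ((p : ℤ_[p]) ^ (r + 1)) * (C a * (X * geomSeries ℤ_[p] ^ 2)) := by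
      rw [C_dvd_iff_forall_dvd_coeff]
      intro n
      rw [map_sub, coeff_multisection, coeff_C_mul, coeff_C_mul, hJ]
      exact ih n
    have h2 := C_dvd_multisection_recipPoly_pow_sub (p := p) (q := p ^ (r + 2))
      (pow_pos (by omega) _) (dvd_pow_self p (by omega))
    rw [Nat.cast_pow] at h2
    have h3 := h2.add (h1.mul_left ((1 - X) ^ 6))
    have e : (1 - X : ℤ_[p]⟦X⟧) ^ 6 * (X * geomSeries ℤ_[p] ^ 2) = X ^ 1 * (1 - X) ^ 4 := by
      linear_combination X * (1 - X) ^ 4 * geomSeries_pow_mul_one_sub_pow (R := ℤ_[p]) 2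
    have h4 := dvd_coeff_recipSeries_pow_sub (p := p) (by omega) (r := r + 1)
      (s := C a * (X ^ 1 * (1 - X) ^ 4))
      (fun m hm => coeff_X_pow_mul_one_sub_X_pow_eq_zero _ (by omega))
      (by
        convert h3 using 1
        rw [← e]
        ring) k
    have e2 : geomSeries ℤ_[p] ^ 6 * (C a * (X ^ 1 * (1 - X) ^ 4)) =
        C a * (X * geomSeries ℤ_[p] ^ 2) := by
      linear_combination C a * X * geomSeries ℤ_[p] ^ 2 *
        geomSeries_pow_mul_one_sub_pow (R := ℤ_[p]) 4
    rw [e2, coeff_C_mul, hJ] at h4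
    convert h4 using 1
    push_cast
    ring

theorem coe_recip (l : ℕ) : (recip p l : ℚ_[p]) = if p ∣ l then 0 else (l : ℚ_[p])⁻¹ := by
  split_ifs with h
  · rw [recip_of_dvd h, PadicInt.coe_zero]
  · have h1 := congrArg (fun z : ℤ_[p] => (z : ℚ_[p])) (cast_mul_recip h)
    push_cast at h1
    exact eq_inv_of_mul_eq_one_right h1

/-- Tuples with an entry divisible by `p` contribute `0` to the coefficient, since `recip p` vanishes
there. -/
theorem coe_recipSum (n N : ℕ) :
    ((recipSum p n N : ℚ) : ℚ_[p]) = (coeff N (recipSeries p ^ n) : ℤ_[p]) := by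
  have h1 : recipSeries p ^ n = ∏ _i : Fin n, recipSeries p := by simp
  have h2 : coeff N (recipSeries p ^ n) =
      ∑ l ∈ Finset.Nat.antidiagonalTuple n N, ∏ i, recip p (l i) := by
    rw [h1, coeff_prod]
    refine sum_bij' (fun l _ => ⇑l) (fun l _ => Finsupp.equivFunOnFinite.symm l) ?_ ?_ ?_ ?_ ?_
    · intro l hl
      rw [mem_finsuppAntidiag] at hl
      exact Finset.Nat.mem_antidiagonalTuple.2 hl.1
    · intro l hl
      rw [mem_finsuppAntidiag]
      exact ⟨Finset.Nat.mem_antidiagonalTuple.1 hl, subset_univ _⟩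
    · intro l _
      ext; simp
    · intro l _
      ext; simp
    · intro l _
      simp [recipSeries]
  rw [h2, recipSum, sum_filter, PadicInt.coe_sum, Rat.cast_sum]
  refine sum_congr rfl fun l _ => ?_
  have hprod : ((∏ i, recip p (l i) : ℤ_[p]) : ℚ_[p]) = ∏ i, (recip p (l i) : ℚ_[p]) :=
    map_prod PadicInt.Coe.ringHom _ _
  rw [hprod]
  simp only [coe_recip]
  have hmem : ∀ i, l i ∈ primeTo p ↔ ¬ p ∣ l i := by
    intro i
    rw [primeTo, Set.mem_ofPred_eq, Nat.coprime_comm, Nat.Prime.coprime_iff_not_dvd Fact.out]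
    refine ⟨And.right, fun h => ⟨Nat.pos_of_ne_zero ?_, h⟩⟩
    rintro h0
    exact h (h0 ▸ dvd_zero p)
  split_ifs with h
  · rw [prod_congr rfl fun i _ => if_neg ((hmem i).1 (h i))]
    simp
  · push Not at h
    obtain ⟨i, hi⟩ := h
    rw [prod_eq_zero (mem_univ i)]
    · simp
    · rw [if_pos]
      by_contra h'
      exact hi ((hmem i).2 h')

theorem ratModEq_of_coe_sub_eq {r : ℕ} {x y : ℚ} {w : ℤ_[p]}
    (h : ((x - y : ℚ) : ℚ_[p]) = (p : ℚ_[p]) ^ r * w) : RatModEq (p ^ r) x y := by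
  have hp0 : (p : ℚ) ≠ 0 := by exact_mod_cast (Fact.out : p.Prime).ne_zero
  have hp0' : (p : ℚ_[p]) ≠ 0 := by exact_mod_cast (Fact.out : p.Prime).ne_zero
  refine ⟨(x - y) / p ^ r, ?_, ?_⟩
  · have h1 : (((x - y) / p ^ r : ℚ) : ℚ_[p]) = w := by
      rw [Rat.cast_div, h]
      push_cast
      field_simp
    have h2 := PadicInt.isUnit_den ((x - y) / p ^ r) (by rw [h1]; exact PadicInt.norm_le_one w)
    rw [PadicInt.isUnit_iff, PadicInt.norm_natCast_eq_one_iff] at h2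
    exact Nat.Coprime.pow_right r h2.symm
  · push_cast
    field_simp

end

theorem theorem3 (p r : ℕ) (hp : p.Prime) (hp11 : 11 ≤ p) (hr : 2 ≤ r) :
    RatModEq (p ^ r) (recipSum p 6 (p ^ r))
      (-((Nat.factorial 5 : ℚ) / 18) * (p : ℚ) ^ (r - 1) * bernoulli (p - 3) ^ 2) := by
  have : Fact p.Prime := ⟨hp⟩
  obtain ⟨r, rfl⟩ := Nat.exists_eq_add_of_le' hr
  obtain ⟨b, hb⟩ := exists_padicInt_bernoulli p
  obtain ⟨u, hu⟩ := isUnit_natCast_of_lt (p := p) (n := 3) (by norm_num) (by omega)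
  have ha : 3 * (↑u⁻¹ * (-20 * b (p - 3) ^ 2)) = -20 * b (p - 3) ^ 2 := by
    rw [← mul_assoc, show (3 : ℤ_[p]) = u by rw [hu]; norm_num, Units.mul_inv, one_mul]
  generalize (↑u⁻¹ * (-20 * b (p - 3) ^ 2)) = a at ha
  obtain ⟨w, hw⟩ := pow_dvd_coeff_recipSeries_pow_sub hp11 hb ha r 1
  refine ratModEq_of_coe_sub_eq (w := w) ?_
  have h1 := congrArg (fun z : ℤ_[p] => (z : ℚ_[p])) hw
  have h2 := congrArg (fun z : ℤ_[p] => (z : ℚ_[p])) ha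
  have h3 := hb (p - 3) (by omega)
  rw [Rat.cast_sub, coe_recipSum]
  simp only [one_mul, Nat.cast_one, mul_one] at h1
  push_cast at h1 h2
  have h20 : ((20 : ℤ_[p]) : ℚ_[p]) = 20 := map_ofNat PadicInt.Coe.ringHom 20
  have h3' : ((3 : ℤ_[p]) : ℚ_[p]) = 3 := map_ofNat PadicInt.Coe.ringHom 3
  rw [h20, h3'] at h2
  rw [show r + 2 - 1 = r + 1 by omega, show Nat.factorial 5 = 120 by rfl]
  push_cast
  rw [← h3, ← h1]
  linear_combination (p : ℚ_[p]) ^ (r + 1) / 3 * h2
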